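/- All vector lattices are real. For a set $A$ let $\mathrm{FVL}(A)$ be the vector sublattice of $\mathbb R^{\mathbb R^A}$ (pointwise operations and order) generated by the evaluations $\delta_a\colon x\mapsto x(a)$, $a\in A$; identify $a$ with $\delta_a$. A lattice homomorphism is a linear map preserving $\vee$ and $\wedge$. A lattice seminorm on a vector lattice is a seminorm $\nu$ such that $|f|\le|g|$ implies $\nu(f)\le\nu(g)$; it is a lattice norm if moreover $\nu(f)=0$ only for $f=0$. The completion of a vector lattice $L$ with respect to a lattice norm is the Banach lattice (unique up to lattice isometry) that contains $L$ isometrically as a dense sublattice. A Banach lattice $X$ whose closed unit ball contains $A$ is a free Banach lattice over $A$, written $X=\mathrm{FBL}(A)$, if every map $\varphi\colon A\to Y$ into a Banach lattice $Y$ with $\sup_{a\in A}\|\varphi(a)\|\le1$ extends uniquely to a lattice homomorphism $\tilde\varphi\colon X\to Y$, and $\|\tilde\varphi\|\le1$. Theorem. Let $A$ be a set. Then $\mathrm{FVL}(A)$ is the free vector lattice over $A$: every map from $A$ to a vector lattice $Y$ extends uniquely to a lattice homomorphism $\mathrm{FVL}(A)\to Y$. There is a largest lattice seminorm $\nu$ on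 $\mathrm{FVL}(A)$ with $\nu(a)\le1$ for all $a\in A$, that is, a lattice seminorm $\nu$ with this property such that $\nu'\le\nu$ pointwise for every lattice seminorm $\nu'$ with this property. This $\nu$ is a lattice norm. The completion of $\mathrm{FVL}(A)$ with respect to $\nu$ exists and is a free Banach lattice over $A$. Conversely, let $X$ be any free Banach lattice over $A$. Then there is a lattice homomorphism $j\colon\mathrm{FVL}(A)\to X$ that fixes every $a\in A$, it exhibits $X$ as the completion of $\mathrm{FVL}(A)$ with respect to $\nu$, and the FBL norm $f\mapsto\|j(f)\|$ is the greatest lattice norm on $\mathrm{FVL}(A)$ with $\|a\|\le1$ for all $a\in A$. -/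

import Mathlib

universe u v w

/-!
Conventions.  A vector lattice is a type `X` with
`[AddCommGroup X] [Module ℝ X] [Lattice X] [IsOrderedAddMonoid X] [IsOrderedModule ℝ X]`.
A Banach lattice is a type `X` with
`[NormedAddCommGroup X] [NormedSpace ℝ X] [Lattice X] [IsOrderedAddMonoid X]
[IsOrderedModule ℝ X] [HasSolidNorm X] [CompleteSpace X]`.
-/

/-- A linear map between vector lattices is a lattice homomorphism if it preserves the lattice
operations. -/
structure IsLatticeHom {X : Type u} {Y : Type v}
    [AddCommGroup X] [Module ℝ X] [Lattice X] [AddCommGroup Y] [Module ℝ Y] [Lattice Y]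
    (T : X →ₗ[ℝ] Y) : Prop where
  map_sup : ∀ x y : X, T (x ⊔ y) = T x ⊔ T y
  map_inf : ∀ x y : X, T (x ⊓ y) = T x ⊓ T y

/-- `X`, together with the inclusion `ι : A → X`, is a free vector lattice over `A`: every function
from `A` to a vector lattice extends uniquely to a lattice homomorphism on `X`. -/
structure IsFreeVectorLattice {A : Type u} {X : Type w}
    [AddCommGroup X] [Module ℝ X] [Lattice X] [IsOrderedAddMonoid X] [IsOrderedModule ℝ X]
    (ι : A → X) : Prop where
  injective : Function.Injective ι
  existsUnique_extension : ∀ (Y : Type v) [AddCommGroup Y] [Module ℝ Y] [Lattice Y]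
    [IsOrderedAddMonoid Y] [IsOrderedModule ℝ Y] (φ : A → Y),
    ∃! T : X →ₗ[ℝ] Y, IsLatticeHom T ∧ ∀ a, T (ι a) = φ a

/-- The vector sublattice generated by a set `s`: the smallest linear subspace that contains `s`
and is closed under the lattice operations. -/
def vectorSublatticeSpan {X : Type u} [AddCommGroup X] [Module ℝ X] [Lattice X] (s : Set X) :
    Submodule ℝ X :=
  sInf {M : Submodule ℝ X | s ⊆ M ∧ (∀ x ∈ M, ∀ y ∈ M, x ⊔ y ∈ M) ∧
    (∀ x ∈ M, ∀ y ∈ M, x ⊓ y ∈ M)}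

theorem subset_vectorSublatticeSpan {X : Type u} [AddCommGroup X] [Module ℝ X] [Lattice X]
    (s : Set X) : s ⊆ vectorSublatticeSpan s := by
  intro x hx
  simp only [vectorSublatticeSpan, SetLike.mem_coe, Submodule.mem_sInf]
  exact fun M hM => hM.1 hx

theorem sup_mem_vectorSublatticeSpan {X : Type u} [AddCommGroup X] [Module ℝ X] [Lattice X]
    {s : Set X} {x y : X} (hx : x ∈ vectorSublatticeSpan s) (hy : y ∈ vectorSublatticeSpan s) :
    x ⊔ y ∈ vectorSublatticeSpan s := by
  simp only [vectorSublatticeSpan, Submodule.mem_sInf] at hx hy ⊢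
  exact fun M hM => hM.2.1 x (hx M hM) y (hy M hM)

theorem inf_mem_vectorSublatticeSpan {X : Type u} [AddCommGroup X] [Module ℝ X] [Lattice X]
    {s : Set X} {x y : X} (hx : x ∈ vectorSublatticeSpan s) (hy : y ∈ vectorSublatticeSpan s) :
    x ⊓ y ∈ vectorSublatticeSpan s := by
  simp only [vectorSublatticeSpan, Submodule.mem_sInf] at hx hy ⊢
  exact fun M hM => hM.2.2 x (hx M hM) y (hy M hM)

/-- `FVL A`: the vector sublattice of `ℝ^(ℝ^A)`, with the pointwise operations and order,
generated by the evaluation functionals `δ_a : x ↦ x a`, `a ∈ A`. -/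
def FVL (A : Type u) : Type u :=
  vectorSublatticeSpan (Set.range fun (a : A) (x : A → ℝ) => x a)

namespace FVL

instance instAddCommGroup (A : Type u) : AddCommGroup (FVL A) :=
  inferInstanceAs (AddCommGroup
    (vectorSublatticeSpan (Set.range fun (a : A) (x : A → ℝ) => x a)))

instance instModule (A : Type u) : Module ℝ (FVL A) :=
  inferInstanceAs (Module ℝ
    (vectorSublatticeSpan (Set.range fun (a : A) (x : A → ℝ) => x a)))

instance instLattice (A : Type u) : Lattice (FVL A) :=
  Subtype.lattice (fun _ _ hx hy => sup_mem_vectorSublatticeSpan hx hy)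
    (fun _ _ hx hy => inf_mem_vectorSublatticeSpan hx hy)

instance instIsOrderedAddMonoid (A : Type u) : IsOrderedAddMonoid (FVL A) where
  add_le_add_left _ _ h k := fun x => add_le_add_left (h x) (k.1 x)

instance instIsOrderedModule (A : Type u) : IsOrderedModule ℝ (FVL A) where
  smul_le_smul_of_nonneg_left _ hc _ _ h := fun x => mul_le_mul_of_nonneg_left (h x) hc
  smul_le_smul_of_nonneg_right _ hf _ _ h := fun x => mul_le_mul_of_nonneg_right h (hf x)

/-- The inclusion `a ↦ δ_a` of `A` into `FVL A`. -/
def of {A : Type u} (a : A) : FVL A :=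
  ⟨fun x => x a, subset_vectorSublatticeSpan _ ⟨a, rfl⟩⟩

end FVL

/-- A seminorm on a vector lattice is a lattice seminorm if `|f| ≤ |g|` implies `p f ≤ p g`. -/
def IsLatticeSeminorm {X : Type u} [AddCommGroup X] [Module ℝ X] [Lattice X]
    (p : Seminorm ℝ X) : Prop :=
  ∀ f g : X, |f| ≤ |g| → p f ≤ p g

/-- A lattice norm is a lattice seminorm that vanishes only at `0`. -/
def IsLatticeNorm {X : Type u} [AddCommGroup X] [Module ℝ X] [Lattice X]
    (p : Seminorm ℝ X) : Prop :=
  IsLatticeSeminorm p ∧ ∀ f : X, p f = 0 → f = 0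

/-- The Banach lattice `X`, together with `j : L → X`, is the completion of the vector lattice `L`
with respect to the lattice norm `p`: the map `j` is an isometric lattice embedding with dense
range. -/
structure IsLatticeCompletion {L : Type u} [AddCommGroup L] [Module ℝ L] [Lattice L]
    (p : Seminorm ℝ L) {X : Type v} [NormedAddCommGroup X] [NormedSpace ℝ X] [Lattice X]
    [IsOrderedAddMonoid X] [IsOrderedModule ℝ X] [HasSolidNorm X] [CompleteSpace X]
    (j : L →ₗ[ℝ] X) : Prop where
  isLatticeHom : IsLatticeHom j
  norm_eq : ∀ f : L, ‖j f‖ = p f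
  denseRange : DenseRange j

/-- The Banach lattice `X`, together with the inclusion `ι : A → X` into its unit ball, is a free
Banach lattice over `A`: every function from `A` to the unit ball of a Banach lattice `Y` has
exactly one extension to a lattice homomorphism on `X`, and this extension is contractive. -/
structure IsFreeBanachLattice {A : Type u} {X : Type w}
    [NormedAddCommGroup X] [NormedSpace ℝ X] [Lattice X] [IsOrderedAddMonoid X]
    [IsOrderedModule ℝ X] [HasSolidNorm X] [CompleteSpace X] (ι : A → X) : Prop where
  injective : Function.Injective ι
  norm_le_one : ∀ a, ‖ι a‖ ≤ 1
  exists_extension : ∀ (Y : Type v) [NormedAddCommGroup Y] [NormedSpace ℝ Y] [Lattice Y]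
    [IsOrderedAddMonoid Y] [IsOrderedModule ℝ Y] [HasSolidNorm Y] [CompleteSpace Y]
    (φ : A → Y), (∀ a, ‖φ a‖ ≤ 1) →
    ∃ T : X →ₗ[ℝ] Y, (IsLatticeHom T ∧ ∀ a, T (ι a) = φ a) ∧ (∀ x, ‖T x‖ ≤ ‖x‖) ∧
      ∀ S : X →ₗ[ℝ] Y, (IsLatticeHom S ∧ ∀ a, S (ι a) = φ a) → S = T

/-! ### Vector lattices -/

section VectorLattice

/-! Freeness of `FVL A` says that a lattice-linear relation between coordinate functions on `ℝ^A`
persists in every vector lattice `Y`. The candidate graph of the extension of `φ` is the vector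
sublattice of `ℝ^(ℝ^A) × Y` generated by the pairs `(δ_a, φ a)`; it must be single-valued. By the
sup-inf normal form this reduces to finite infima of linear forms that are nowhere positive on
`ℝ^A`. Gordan's alternative then yields nonnegative coefficients, not all zero, whose combination of
the forms vanishes; the same combination in `Y` bounds a positive multiple of the infimum by `0`. No
representation of `Y` and no Archimedean property is needed.

The largest seminorm is the supremum of all admissible ones. It is finite because the elements on
which they are uniformly bounded form a vector sublattice containing the generators. It is a norm
because suitably scaled evaluations at bounded points are admissible, and these already separate
elements of `FVL A`, each of which depends on finitely many coordinates.

If `T` is the lift of a map into the unit ball of a Banach lattice, then `f ↦ ‖T f‖` is admissible,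
so `T` is contractive for the largest seminorm and extends to the completion. Uniqueness rests on
automatic continuity of lattice homomorphisms on Banach lattices. The converse is the usual
uniqueness of free objects, with contractivity in both directions giving isometry. -/

theorem smul_sup_of_nonneg {X : Type u} [AddCommGroup X] [Module ℝ X] [Lattice X]
    [IsOrderedModule ℝ X] {c : ℝ} (hc : 0 ≤ c) (x y : X) : c • (x ⊔ y) = c • x ⊔ c • y := by
  rcases hc.eq_or_lt with rfl | hc
  · simp
  · exact (OrderIso.smulRight (β := X) hc).map_sup x y

theorem smul_inf_of_nonneg {X : Type u} [AddCommGroup X] [Module ℝ X] [Lattice X]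
    [IsOrderedModule ℝ X] {c : ℝ} (hc : 0 ≤ c) (x y : X) : c • (x ⊓ y) = c • x ⊓ c • y := by
  rcases hc.eq_or_lt with rfl | hc
  · simp
  · exact (OrderIso.smulRight (β := X) hc).map_inf x y

theorem abs_sup_le_add {X : Type u} [AddCommGroup X] [Lattice X] [IsOrderedAddMonoid X]
    (x y : X) : |x ⊔ y| ≤ |x| + |y| := by
  have hx := abs_nonneg x
  have hy := abs_nonneg y
  refine sup_le (sup_le ?_ ?_) ?_
  · exact (le_abs_self x).trans (le_add_of_nonneg_right hy)
  · exact (le_abs_self y).trans (le_add_of_nonneg_left hx)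
  · exact (neg_le_neg le_sup_left).trans ((neg_le_abs x).trans (le_add_of_nonneg_right hy))

theorem abs_inf_le_add {X : Type u} [AddCommGroup X] [Lattice X] [IsOrderedAddMonoid X]
    (x y : X) : |x ⊓ y| ≤ |x| + |y| := by
  rw [← abs_neg, neg_inf, ← abs_neg x, ← abs_neg y]
  exact abs_sup_le_add _ _

/-- A vector sublattice that contains `s` contains the vector sublattice generated by `s`. -/
theorem vectorSublatticeSpan_le {X : Type u} [AddCommGroup X] [Module ℝ X] [Lattice X] {s : Set X}
    {M : Submodule ℝ X} (hs : s ⊆ M)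
    (hsup : ∀ x ∈ M, ∀ y ∈ M, x ⊔ y ∈ M) (hinf : ∀ x ∈ M, ∀ y ∈ M, x ⊓ y ∈ M) :
    vectorSublatticeSpan s ≤ M :=
  sInf_le ⟨hs, hsup, hinf⟩

variable {X : Type u} [AddCommGroup X] [Module ℝ X] [Lattice X] [IsOrderedAddMonoid X]
  [IsOrderedModule ℝ X]

/-- The lattice generated by a linear subspace of a vector lattice is a linear subspace. -/
def latticeClosureSubmodule (S : Submodule ℝ X) : Submodule ℝ X where
  carrier := latticeClosure (S : Set X)
  zero_mem' := subset_latticeClosure S.zero_mem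
  add_mem' := by
    have hsub : IsSublattice (latticeClosure (S : Set X)) := isSublattice_latticeClosure
    -- Translations preserve both lattice operations, so closure under addition is proved one
    -- summand at a time: first with `x` in `S`, then with `x` in the closure.
    have h₁ : ∀ x ∈ S, ∀ y ∈ latticeClosure (S : Set X), x + y ∈ latticeClosure (S : Set X) := by
      intro x hx y hy
      refine latticeClosure_min (t := {y | x + y ∈ latticeClosure (S : Set X)})
        (fun y hy => subset_latticeClosure (S.add_mem hx hy)) ⟨?_, ?_⟩ hy
      · intro a ha b hb
        simpa only [Set.mem_ofPred_eq, add_sup] using hsub.1 ha hb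
      · intro a ha b hb
        simpa only [Set.mem_ofPred_eq, add_inf] using hsub.2 ha hb
    intro x y hx hy
    refine latticeClosure_min (t := {x | x + y ∈ latticeClosure (S : Set X)})
      (fun x hx => h₁ x hx y hy) ⟨?_, ?_⟩ hx
    · intro a ha b hb
      simpa only [Set.mem_ofPred_eq, sup_add] using hsub.1 ha hb
    · intro a ha b hb
      simpa only [Set.mem_ofPred_eq, inf_add] using hsub.2 ha hb
  smul_mem' := by
    have hsub : IsSublattice (latticeClosure (S : Set X)) := isSublattice_latticeClosure
    -- Nonnegative scalars preserve the lattice operations and negation exchanges them, so the two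
    -- cases are treated separately.
    have hpos : ∀ c : ℝ, 0 ≤ c → ∀ x ∈ latticeClosure (S : Set X),
        c • x ∈ latticeClosure (S : Set X) := by
      intro c hc x hx
      refine latticeClosure_min (t := {x | c • x ∈ latticeClosure (S : Set X)})
        (fun x hx => subset_latticeClosure (S.smul_mem c hx)) ⟨?_, ?_⟩ hx
      · intro a ha b hb
        simpa only [Set.mem_ofPred_eq, smul_sup_of_nonneg hc] using hsub.1 ha hb
      · intro a ha b hb
        simpa only [Set.mem_ofPred_eq, smul_inf_of_nonneg hc] using hsub.2 ha hb
    have hneg : ∀ x ∈ latticeClosure (S : Set X), -x ∈ latticeClosure (S : Set X) := by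
      intro x hx
      refine latticeClosure_min (t := {x | -x ∈ latticeClosure (S : Set X)})
        (fun x hx => subset_latticeClosure (S.neg_mem hx)) ⟨?_, ?_⟩ hx
      · intro a ha b hb
        simpa only [Set.mem_ofPred_eq, neg_sup] using hsub.2 ha hb
      · intro a ha b hb
        simpa only [Set.mem_ofPred_eq, neg_inf] using hsub.1 ha hb
    intro c x hx
    rcases le_total 0 c with hc | hc
    · exact hpos c hc x hx
    · simpa using hneg _ (hpos (-c) (neg_nonneg.2 hc) x hx)

theorem vectorSublatticeSpan_le_latticeClosureSubmodule (s : Set X) :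
    vectorSublatticeSpan s ≤ latticeClosureSubmodule (Submodule.span ℝ s) := by
  have hsub : IsSublattice (latticeClosure (Submodule.span ℝ s : Set X)) :=
    isSublattice_latticeClosure
  exact vectorSublatticeSpan_le (fun x hx => subset_latticeClosure (Submodule.subset_span hx))
    (fun x hx y hy => hsub.1 hx hy) (fun x hx y hy => hsub.2 hx hy)

/-- Every element of the vector sublattice generated by `s` is a finite supremum of finite infima
of linear combinations of elements of `s`. -/
theorem mem_supClosure_infClosure_of_mem_vectorSublatticeSpan {s : Set X} {x : X}
    (hx : x ∈ vectorSublatticeSpan s) :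
    x ∈ supClosure (infClosure (Submodule.span ℝ s : Set X)) := by
  have h : x ∈ latticeClosure (Submodule.span ℝ s : Set X) :=
    vectorSublatticeSpan_le_latticeClosureSubmodule s hx
  -- Lattice-ordered groups are distributive; distributivity is what puts the generated sublattice
  -- into sup-inf form.
  let _ : DistribLattice X := AddCommGroup.toDistribLattice X
  have e := supClosure_infClosure (Submodule.span ℝ s : Set X)
  exact e ▸ h

end VectorLattice

/-! ### A theorem of the alternative -/

/-- Gordan's alternative: a subspace of `ℝ^I` without strictly positive vectors is annihilated by
a nonzero nonnegative vector. -/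
theorem exists_nonneg_annihilator {I : Type*} [Fintype I] (W : Submodule ℝ (I → ℝ))
    (hW : ∀ w ∈ W, ∃ i, w i ≤ 0) :
    ∃ c : I → ℝ, (∀ i, 0 ≤ c i) ∧ 0 < ∑ i, c i ∧ ∀ w ∈ W, ∑ i, c i * w i = 0 := by
  classical
  have hopen : IsOpen {w : I → ℝ | ∀ i, 0 < w i} := by
    simp only [Set.ofPred_forall]
    exact isOpen_iInter_of_finite fun i => isOpen_lt continuous_const (continuous_apply i)
  have hconv : Convex ℝ {w : I → ℝ | ∀ i, 0 < w i} := by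
    intro x hx y hy a b ha hb hab i
    exact (convex_Ioi (0 : ℝ)) (hx i) (hy i) ha hb hab
  have hdisj : Disjoint {w : I → ℝ | ∀ i, 0 < w i} (W : Set (I → ℝ)) := by
    rw [Set.disjoint_left]
    intro w hw hwW
    obtain ⟨i, hi⟩ := hW w hwW
    exact absurd (hw i) hi.not_gt
  -- Separate the open positive orthant from `W`; the wanted vector is minus the coefficient vector
  -- of the separating functional.
  obtain ⟨f, u, hfu, huf⟩ := geometric_hahn_banach_open hconv hopen W.convex hdisj
  have hf0 : ∀ w ∈ W, f w = 0 := by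
    intro w hw
    by_contra hne
    -- A functional bounded below on a subspace vanishes there: this multiple of `w` would have
    -- value `u - 1 < u`.
    have h := huf (((u - 1) / f w) • w) (W.smul_mem _ hw)
    rw [map_smul, smul_eq_mul, div_mul_cancel₀ _ hne] at h
    linarith
  have hu0 : u ≤ 0 := by simpa using huf 0 W.zero_mem
  have hfe : ∀ w : I → ℝ, f w = ∑ i, f (Pi.single i 1) * w i := by
    intro w
    conv_lhs => rw [pi_eq_sum_univ' w]
    simp [map_sum, mul_comm]
  have hneg : ∀ w : I → ℝ, (∀ i, 0 < w i) → f w < 0 := fun w hw => (hfu w hw).trans_le hu0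
  refine ⟨fun i => -f (Pi.single i 1), ?_, ?_, ?_⟩
  · intro i
    -- The unit vectors lie only on the boundary of the open orthant, so the sign of `f` there is
    -- obtained as a limit from inside.
    have hlim : Filter.Tendsto (fun ε : ℝ => f (Pi.single i 1 + ε • (1 : I → ℝ)))
        (nhdsWithin 0 (Set.Ioi 0)) (nhds (f (Pi.single i 1))) := by
      have hc : Continuous fun ε : ℝ => f (Pi.single i 1 + ε • (1 : I → ℝ)) := by fun_prop
      have := hc.tendsto 0
      simp only [zero_smul, add_zero] at this
      exact this.mono_left nhdsWithin_le_nhds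
    refine neg_nonneg.2 (le_of_tendsto hlim ?_)
    filter_upwards [self_mem_nhdsWithin] with ε hε
    refine (hneg _ fun k => ?_).le
    have h₁ : 0 ≤ (Pi.single i 1 : I → ℝ) k := by
      by_cases h : k = i
      · subst h; simp
      · simp [h]
    simpa using add_pos_of_nonneg_of_pos h₁ hε
  · have h := hneg 1 fun i => by simp
    rw [hfe] at h
    simpa using h
  · intro w hw
    have h := hf0 w hw
    rw [hfe] at h
    simpa using h

/-- If a finite infimum of linear forms is nowhere positive on `ℝ^A`, then the corresponding
infimum of linear combinations is nonpositive in every vector lattice. -/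
theorem inf_linearCombination_nonpos {A : Type u} {Y : Type v} [AddCommGroup Y] [Module ℝ Y]
    [Lattice Y] [IsOrderedAddMonoid Y] [IsOrderedModule ℝ Y] (φ : A → Y) {I : Type*} [Fintype I]
    (l : I → A →₀ ℝ) (hl : ∀ x : A → ℝ, ∃ i, Finsupp.linearCombination ℝ x (l i) ≤ 0) {y : Y}
    (hy : ∀ i, y ≤ Finsupp.linearCombination ℝ φ (l i)) : y ≤ 0 := by
  classical
  let F : (A → ℝ) →ₗ[ℝ] (I → ℝ) :=
    { toFun := fun x i => Finsupp.linearCombination ℝ x (l i)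
      map_add' := fun x y => by
        ext i; simp [Finsupp.linearCombination_apply, Finsupp.sum, mul_add, Finset.sum_add_distrib]
      map_smul' := fun c x => by
        ext i
        simp [Finsupp.linearCombination_apply, Finsupp.sum, Finset.mul_sum, mul_left_comm] }
  obtain ⟨c, hc, hpos, hann⟩ := exists_nonneg_annihilator (LinearMap.range F) (by
    rintro _ ⟨x, rfl⟩
    exact hl x)
  have hzero : ∑ i, c i • l i = 0 := by
    ext a
    -- Testing the annihilator on the image of the unit vector at `a` reads off the coefficient of
    -- `a` in `∑ i, c i • l i`.
    have h := hann _ ⟨Pi.single a 1, rfl⟩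
    have e : ∀ i, F (Pi.single a 1) i = l i a := by
      intro i
      change Finsupp.linearCombination ℝ (Pi.single a (1 : ℝ)) (l i) = l i a
      simp [Finsupp.linearCombination_apply, Finsupp.sum, Pi.single_apply]
      exact fun h => h.symm
    simpa [e, Finsupp.finsetSum_apply] using h
  have h₁ : (∑ i, c i) • y ≤ 0 := by
    calc (∑ i, c i) • y = ∑ i, c i • y := Finset.sum_smul
      _ ≤ ∑ i, c i • Finsupp.linearCombination ℝ φ (l i) :=
        Finset.sum_le_sum fun i _ => smul_le_smul_of_nonneg_left (hy i) (hc i)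
      _ = Finsupp.linearCombination ℝ φ (∑ i, c i • l i) := by simp [map_sum]
      _ = 0 := by rw [hzero, map_zero]
  have h₂ := smul_le_smul_of_nonneg_left h₁ (inv_nonneg.2 hpos.le)
  rwa [smul_smul, inv_mul_cancel₀ hpos.ne', one_smul, smul_zero] at h₂

/-! ### The free vector lattice -/

namespace IsLatticeHom

variable {X : Type u} {Y : Type v} {Z : Type w} [AddCommGroup X] [Module ℝ X] [Lattice X]
  [AddCommGroup Y] [Module ℝ Y] [Lattice Y] [AddCommGroup Z] [Module ℝ Z] [Lattice Z]

theorem map_abs {T : X →ₗ[ℝ] Y} (hT : IsLatticeHom T) (x : X) : T |x| = |T x| := by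
  rw [abs, abs, hT.map_sup, map_neg]

theorem monotone {T : X →ₗ[ℝ] Y} (hT : IsLatticeHom T) : Monotone T := by
  intro x y h
  rw [← sup_eq_right, ← hT.map_sup, sup_eq_right.2 h]

theorem comp {S : Y →ₗ[ℝ] Z} {T : X →ₗ[ℝ] Y} (hS : IsLatticeHom S) (hT : IsLatticeHom T) :
    IsLatticeHom (S ∘ₗ T) where
  map_sup x y := by simp [hT.map_sup, hS.map_sup]
  map_inf x y := by simp [hT.map_inf, hS.map_inf]

theorem id : IsLatticeHom (LinearMap.id : X →ₗ[ℝ] X) where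
  map_sup _ _ := rfl
  map_inf _ _ := rfl

end IsLatticeHom

namespace FVL

/-- The inclusion of `FVL A` into the functions on `ℝ^A`. -/
def toFun (A : Type u) : FVL A →ₗ[ℝ] ((A → ℝ) → ℝ) where
  toFun f := f.1
  map_add' _ _ := rfl
  map_smul' _ _ := rfl

variable {A : Type u}

theorem toFun_injective : Function.Injective (toFun A) := Subtype.val_injective

theorem isLatticeHom_toFun : IsLatticeHom (toFun A) where
  map_sup _ _ := rfl
  map_inf _ _ := rfl

theorem toFun_of (a : A) (x : A → ℝ) : toFun A (of a) x = x a := rfl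

theorem toFun_mem (f : FVL A) :
    toFun A f ∈ vectorSublatticeSpan (Set.range fun (a : A) (x : A → ℝ) => x a) := f.2

/-- A vector sublattice of `FVL A` that contains the generators is everything. -/
theorem mem_of_generators {M : Submodule ℝ (FVL A)} (hof : ∀ a, of a ∈ M)
    (hsup : ∀ f ∈ M, ∀ g ∈ M, f ⊔ g ∈ M) (hinf : ∀ f ∈ M, ∀ g ∈ M, f ⊓ g ∈ M) (f : FVL A) :
    f ∈ M := by
  have h : vectorSublatticeSpan (Set.range fun (a : A) (x : A → ℝ) => x a) ≤
      M.map (toFun A) := by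
    refine vectorSublatticeSpan_le ?_ ?_ ?_
    · rintro _ ⟨a, rfl⟩
      exact ⟨of a, hof a, rfl⟩
    · rintro _ ⟨f, hf, rfl⟩ _ ⟨g, hg, rfl⟩
      exact ⟨f ⊔ g, hsup f hf g hg, rfl⟩
    · rintro _ ⟨f, hf, rfl⟩ _ ⟨g, hg, rfl⟩
      exact ⟨f ⊓ g, hinf f hf g hg, rfl⟩
  obtain ⟨g, hg, hgf⟩ := h (toFun_mem f)
  rwa [← toFun_injective hgf]

theorem of_injective : Function.Injective (of : A → FVL A) := by
  classical
  intro a b h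
  by_contra hab
  have h' := congrArg (fun f => toFun A f (Pi.single a 1)) h
  simp [toFun_of, Ne.symm hab] at h'

theorem hom_ext {Y : Type v} [AddCommGroup Y] [Module ℝ Y] [Lattice Y] {S T : FVL A →ₗ[ℝ] Y}
    (hS : IsLatticeHom S) (hT : IsLatticeHom T) (h : ∀ a, S (of a) = T (of a)) : S = T := by
  ext f
  refine mem_of_generators (M := LinearMap.eqLocus S T) h ?_ ?_ f
  · intro f hf g hg
    rw [LinearMap.mem_eqLocus] at *
    rw [hS.map_sup, hT.map_sup, hf, hg]
  · intro f hf g hg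
    rw [LinearMap.mem_eqLocus] at *
    rw [hS.map_inf, hT.map_inf, hf, hg]

/-! ### Extension of maps on generators through the generated graph. -/

theorem linearCombination_pair {Y : Type v} [AddCommGroup Y] [Module ℝ Y] (φ : A → Y)
    (l : A →₀ ℝ) :
    Finsupp.linearCombination ℝ (fun a : A => ((fun x : A → ℝ => x a), φ a)) l =
      (fun x => Finsupp.linearCombination ℝ x l, Finsupp.linearCombination ℝ φ l) := by
  induction l using Finsupp.induction_linear with
  | zero => ext <;> simp
  | add f g hf hg => rw [map_add, hf, hg]; ext <;> simp
  | single a c => ext <;> simp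

/-- The graph of the lattice homomorphism that extends `φ`. -/
def liftGraph {Y : Type v} [AddCommGroup Y] [Module ℝ Y] [Lattice Y] (φ : A → Y) :
    Submodule ℝ (((A → ℝ) → ℝ) × Y) :=
  vectorSublatticeSpan (Set.range fun a : A => ((fun x : A → ℝ => x a), φ a))

/-- The first projection of the graph is a vector sublattice containing all evaluations, so the
graph is defined on all of `FVL A`. -/
theorem exists_mem_liftGraph {Y : Type v} [AddCommGroup Y] [Module ℝ Y] [Lattice Y] (φ : A → Y)
    (f : FVL A) : ∃ y, (toFun A f, y) ∈ liftGraph φ := by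
  suffices h : f ∈ ((liftGraph φ).map (LinearMap.fst ℝ ((A → ℝ) → ℝ) Y)).comap (toFun A) by
    obtain ⟨⟨_, y⟩, hp, rfl⟩ := h
    exact ⟨y, hp⟩
  refine mem_of_generators ?_ ?_ ?_ f
  · exact fun a => ⟨_, subset_vectorSublatticeSpan _ ⟨a, rfl⟩, rfl⟩
  · rintro f ⟨p, hp, hpf⟩ g ⟨q, hq, hqg⟩
    refine ⟨p ⊔ q, sup_mem_vectorSublatticeSpan hp hq, ?_⟩
    rw [isLatticeHom_toFun.map_sup f g, ← hpf, ← hqg]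
    rfl
  · rintro f ⟨p, hp, hpf⟩ g ⟨q, hq, hqg⟩
    refine ⟨p ⊓ q, inf_mem_vectorSublatticeSpan hp hq, ?_⟩
    rw [isLatticeHom_toFun.map_inf f g, ← hpf, ← hqg]
    rfl

section Lift

variable {Y : Type v} [AddCommGroup Y] [Module ℝ Y] [Lattice Y] [IsOrderedAddMonoid Y]
  [IsOrderedModule ℝ Y]

/-- In sup-inf form, each infimum inherits a nonpositive first coordinate from the supremum, and
Gordan's alternative transfers the sign to the second. Applied to an element and its negative, this
makes the graph single-valued. -/
theorem nonpos_of_mem_liftGraph {φ : A → Y} {p : ((A → ℝ) → ℝ) × Y} (hp : p ∈ liftGraph φ)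
    (h : p.1 ≤ 0) : p.2 ≤ 0 := by
  have : IsOrderedModule ℝ (((A → ℝ) → ℝ) × Y) := .of_smul_nonneg fun c hc q hq =>
    ⟨smul_nonneg hc hq.1, smul_nonneg hc hq.2⟩
  obtain ⟨t, ht, hts, rfl⟩ := mem_supClosure_infClosure_of_mem_vectorSublatticeSpan hp
  have hq : ∀ q ∈ t, q.2 ≤ 0 := by
    intro q hqt
    have hq₁ : q.1 ≤ 0 := (show q ≤ t.sup' ht id from Finset.le_sup' id hqt).1.trans h
    obtain ⟨s, hs, hss, rfl⟩ := hts hqt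
    have hlin : ∀ i : s, ∃ l : A →₀ ℝ,
        Finsupp.linearCombination ℝ (fun a : A => ((fun x : A → ℝ => x a), φ a)) l = i.1 := by
      intro i
      exact (Finsupp.mem_span_range_iff_exists_finsupp.1 (hss i.2)).imp fun l hl => by
        rw [Finsupp.linearCombination_apply, hl]
    choose l hl using hlin
    simp only [linearCombination_pair] at hl
    refine inf_linearCombination_nonpos φ l ?_ ?_
    · intro x
      -- A finite infimum of reals is attained, so at each point `x` one of the linear forms is
      -- itself nonpositive.
      obtain ⟨i, his, hi⟩ := Finset.exists_mem_eq_inf' hs fun i => i.1 x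
      refine ⟨⟨i, his⟩, ?_⟩
      have e : (s.inf' hs id).1 x = s.inf' hs fun i => i.1 x :=
        Finset.apply_inf'_eq_inf'_comp hs (fun q : ((A → ℝ) → ℝ) × Y => q.1 x) fun _ _ => rfl
      have h₁ := hq₁ x
      rw [e, hi] at h₁
      have h₂ := congrArg (fun q : ((A → ℝ) → ℝ) × Y => q.1 x) (hl ⟨i, his⟩)
      exact h₂.trans_le h₁
    · intro i
      have h₁ : (s.inf' hs id).2 ≤ i.1.2 := (Finset.inf'_le id i.2).2
      rwa [← hl i] at h₁
  -- The supremum is compared with an upper bound of `t` in the product whose second coordinate is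
  -- `0`.
  exact (show t.sup' ht id ≤ ((t.sup' ht id).1, 0) from
    Finset.sup'_le ht id fun q hqt => ⟨(Finset.le_sup' id hqt).1, hq q hqt⟩).2

theorem eq_zero_of_mem_liftGraph {φ : A → Y} {y : Y} (h : (0, y) ∈ liftGraph φ) : y = 0 := by
  refine le_antisymm (nonpos_of_mem_liftGraph h le_rfl) ?_
  have h' := nonpos_of_mem_liftGraph ((liftGraph φ).neg_mem h) (by simp)
  simpa using h'

theorem eq_of_mem_liftGraph {φ : A → Y} {f : (A → ℝ) → ℝ} {y z : Y} (hy : (f, y) ∈ liftGraph φ)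
    (hz : (f, z) ∈ liftGraph φ) : y = z := by
  have h := (liftGraph φ).sub_mem hy hz
  rw [Prod.mk_sub_mk, sub_self] at h
  exact sub_eq_zero.1 (eq_zero_of_mem_liftGraph h)

/-- Every map from `A` to a vector lattice extends to a lattice homomorphism on `FVL A`. -/
theorem exists_lift (φ : A → Y) : ∃ T : FVL A →ₗ[ℝ] Y, IsLatticeHom T ∧ ∀ a, T (of a) = φ a := by
  choose T hT using exists_mem_liftGraph φ
  have huniq : ∀ f y, (toFun A f, y) ∈ liftGraph φ → T f = y := fun f y h =>
    eq_of_mem_liftGraph (hT f) h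
  refine ⟨⟨⟨T, fun f g => huniq _ _ ?_⟩, fun c f => huniq _ _ ?_⟩,
    ⟨fun f g => huniq _ _ ?_, fun f g => huniq _ _ ?_⟩, fun a => huniq _ _ ?_⟩
  · exact (liftGraph φ).add_mem (hT f) (hT g)
  · exact (liftGraph φ).smul_mem c (hT f)
  · exact sup_mem_vectorSublatticeSpan (hT f) (hT g)
  · exact inf_mem_vectorSublatticeSpan (hT f) (hT g)
  · exact subset_vectorSublatticeSpan _ ⟨a, rfl⟩

end Lift

theorem isFreeVectorLattice (A : Type u) : IsFreeVectorLattice.{u, v, u} (of : A → FVL A) where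
  injective := of_injective
  existsUnique_extension Y _ _ _ _ _ φ := by
    obtain ⟨T, hT, hTφ⟩ := exists_lift φ
    exact ⟨T, ⟨hT, hTφ⟩, fun S hS => hom_ext hS.1 hT fun a => (hS.2 a).trans (hTφ a).symm⟩

/-! ### The greatest lattice seminorm -/

/-- The lattice seminorms for which all generators have norm at most `1`. -/
def contractiveSeminorms (A : Type u) : Set (Seminorm ℝ (FVL A)) :=
  {p | IsLatticeSeminorm p ∧ ∀ a : A, p (of a) ≤ 1}

/-- The pullback of a solid norm under a lattice homomorphism is a lattice seminorm. -/
theorem isLatticeSeminorm_comp {L : Type u} [AddCommGroup L] [Module ℝ L] [Lattice L] {Y : Type v}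
    [NormedAddCommGroup Y] [NormedSpace ℝ Y] [Lattice Y] [HasSolidNorm Y] {T : L →ₗ[ℝ] Y}
    (hT : IsLatticeHom T) : IsLatticeSeminorm ((normSeminorm ℝ Y).comp T) := by
  intro f g h
  refine norm_le_norm_of_abs_le_abs ?_
  rw [← hT.map_abs, ← hT.map_abs]
  exact hT.monotone h

theorem _root_.IsLatticeSeminorm.le_add_of_abs_le {L : Type u} [AddCommGroup L] [Module ℝ L]
    [Lattice L] [IsOrderedAddMonoid L] {p : Seminorm ℝ L} (hp : IsLatticeSeminorm p) {f g h : L}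
    (hfgh : |f| ≤ |g| + |h|) : p f ≤ p g + p h := by
  calc p f ≤ p (|g| + |h|) :=
        hp _ _ (hfgh.trans (le_abs_self _))
    _ ≤ p |g| + p |h| := map_add_le_add p _ _
    _ ≤ p g + p h := add_le_add (hp _ _ (abs_abs g).le) (hp _ _ (abs_abs h).le)

/-- The uniformly bounded elements form a vector sublattice, because `|f ⊔ g|` and `|f ⊓ g|` are at
most `|f| + |g|`; the generators have bound `1`. -/
theorem exists_bound (f : FVL A) : ∃ C, ∀ p ∈ contractiveSeminorms A, p f ≤ C := by
  let M : Submodule ℝ (FVL A) :=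
    { carrier := {f | ∃ C, ∀ p ∈ contractiveSeminorms A, p f ≤ C}
      zero_mem' := ⟨0, fun _ _ => (map_zero _).le⟩
      add_mem' := by
        rintro f g ⟨C, hC⟩ ⟨D, hD⟩
        exact ⟨C + D, fun p hp => (map_add_le_add p f g).trans (add_le_add (hC p hp) (hD p hp))⟩
      smul_mem' := by
        rintro c f ⟨C, hC⟩
        refine ⟨‖c‖ * C, fun p hp => ?_⟩
        rw [map_smul_eq_mul]
        exact mul_le_mul_of_nonneg_left (hC p hp) (norm_nonneg c) }
  refine mem_of_generators (M := M) (fun a => ⟨1, fun p hp => hp.2 a⟩) ?_ ?_ f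
  · rintro f ⟨C, hC⟩ g ⟨D, hD⟩
    exact ⟨C + D, fun p hp => (hp.1.le_add_of_abs_le (abs_sup_le_add f g)).trans
      (add_le_add (hC p hp) (hD p hp))⟩
  · rintro f ⟨C, hC⟩ g ⟨D, hD⟩
    exact ⟨C + D, fun p hp => (hp.1.le_add_of_abs_le (abs_inf_le_add f g)).trans
      (add_le_add (hC p hp) (hD p hp))⟩

theorem bddAbove_contractiveSeminorms (A : Type u) : BddAbove (contractiveSeminorms A) := by
  choose C hC using exists_bound (A := A)
  refine Seminorm.bddAbove_iff.2 ⟨C, ?_⟩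
  rintro _ ⟨p, hp, rfl⟩ f
  exact hC f p hp

theorem zero_mem_contractiveSeminorms (A : Type u) : 0 ∈ contractiveSeminorms A :=
  ⟨fun _ _ _ => le_rfl, fun _ => zero_le_one⟩

/-- The free norm: the greatest lattice seminorm for which all generators have norm at most `1`. -/
noncomputable def freeNorm (A : Type u) : Seminorm ℝ (FVL A) := sSup (contractiveSeminorms A)

theorem le_freeNorm {p : Seminorm ℝ (FVL A)} (hp : p ∈ contractiveSeminorms A) :
    p ≤ freeNorm A :=
  le_csSup (bddAbove_contractiveSeminorms A) hp

theorem freeNorm_le {f : FVL A} {C : ℝ} (h : ∀ p ∈ contractiveSeminorms A, p f ≤ C) :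
    freeNorm A f ≤ C := by
  have : Nonempty (contractiveSeminorms A) := ⟨⟨0, zero_mem_contractiveSeminorms A⟩⟩
  rw [freeNorm, Seminorm.sSup_apply (bddAbove_contractiveSeminorms A)]
  exact ciSup_le fun p => h p.1 p.2

theorem isGreatest_freeNorm (A : Type u) : IsGreatest (contractiveSeminorms A) (freeNorm A) :=
  ⟨⟨fun _ g h => freeNorm_le fun _ hp => (hp.1 _ _ h).trans (le_freeNorm hp g),
    fun a => freeNorm_le fun _ hp => hp.2 a⟩, fun _ hp => le_freeNorm hp⟩

/-- An element of `FVL A` depends on finitely many coordinates only. -/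
theorem exists_finset_dependsOn (f : FVL A) :
    ∃ F : Finset A, ∀ x y : A → ℝ, (∀ a ∈ F, x a = y a) → toFun A f x = toFun A f y := by
  classical
  let M : Submodule ℝ (FVL A) :=
    { carrier := {f | ∃ F : Finset A, ∀ x y : A → ℝ, (∀ a ∈ F, x a = y a) →
        toFun A f x = toFun A f y}
      zero_mem' := ⟨∅, fun _ _ _ => rfl⟩
      add_mem' := by
        rintro f g ⟨F, hF⟩ ⟨G, hG⟩
        refine ⟨F ∪ G, fun x y h => ?_⟩
        rw [map_add, Pi.add_apply, Pi.add_apply,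
          hF x y fun a ha => h a (Finset.mem_union_left _ ha),
          hG x y fun a ha => h a (Finset.mem_union_right _ ha)]
      smul_mem' := by
        rintro c f ⟨F, hF⟩
        refine ⟨F, fun x y h => ?_⟩
        rw [map_smul, Pi.smul_apply, Pi.smul_apply, hF x y h] }
  refine mem_of_generators (M := M)
    (fun a => ⟨{a}, fun x y h => h a (Finset.mem_singleton_self a)⟩) ?_ ?_ f
  · rintro f ⟨F, hF⟩ g ⟨G, hG⟩
    refine ⟨F ∪ G, fun x y h => ?_⟩
    rw [isLatticeHom_toFun.map_sup, Pi.sup_apply, Pi.sup_apply,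
      hF x y fun a ha => h a (Finset.mem_union_left _ ha),
      hG x y fun a ha => h a (Finset.mem_union_right _ ha)]
  · rintro f ⟨F, hF⟩ g ⟨G, hG⟩
    refine ⟨F ∪ G, fun x y h => ?_⟩
    rw [isLatticeHom_toFun.map_inf, Pi.inf_apply, Pi.inf_apply,
      hF x y fun a ha => h a (Finset.mem_union_left _ ha),
      hG x y fun a ha => h a (Finset.mem_union_right _ ha)]

/-- Evaluation at a point of `ℝ^A`. -/
def eval (x : A → ℝ) : FVL A →ₗ[ℝ] ℝ := LinearMap.proj x ∘ₗ toFun A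

theorem isLatticeHom_eval (x : A → ℝ) : IsLatticeHom (eval x) where
  map_sup _ _ := rfl
  map_inf _ _ := rfl

/-- Scaled evaluation at a bounded point is a lattice homomorphism to `ℝ` that is contractive on
generators, hence dominated by the free norm. Bounded points suffice by finite dependence. -/
theorem isLatticeNorm_freeNorm (A : Type u) : IsLatticeNorm (freeNorm A) := by
  classical
  refine ⟨(isGreatest_freeNorm A).1.1, fun f hf => toFun_injective ?_⟩
  ext x
  rw [map_zero, Pi.zero_apply]
  obtain ⟨F, hF⟩ := exists_finset_dependsOn f
  -- The point `x` may be unbounded on `A`; truncating it outside `F` does not change the value of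
  -- `f`. The summand `1` in `C` keeps the scaling factor defined when `x` vanishes on `F`.
  let y : A → ℝ := fun a => if a ∈ F then x a else 0
  let C : ℝ := 1 + ∑ a ∈ F, |x a|
  have hS : 0 ≤ ∑ a ∈ F, |x a| := Finset.sum_nonneg fun a _ => abs_nonneg (x a)
  have hC : 0 < C := by positivity
  have hyC : ∀ a, |y a| ≤ C := by
    intro a
    by_cases ha : a ∈ F
    · have h₁ := Finset.single_le_sum (f := fun a => |x a|) (fun a _ => abs_nonneg (x a)) ha
      simp only [y, if_pos ha, C]
      linarith
    · simpa [y, ha] using hC.le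
  let p : Seminorm ℝ (FVL A) := (normSeminorm ℝ ℝ).comp (C⁻¹ • eval y)
  have hp : p ∈ contractiveSeminorms A := by
    refine ⟨isLatticeSeminorm_comp ⟨fun f g => ?_, fun f g => ?_⟩, fun a => ?_⟩
    · simp only [LinearMap.smul_apply, (isLatticeHom_eval y).map_sup]
      exact smul_sup_of_nonneg (inv_nonneg.2 hC.le) _ _
    · simp only [LinearMap.smul_apply, (isLatticeHom_eval y).map_inf]
      exact smul_inf_of_nonneg (inv_nonneg.2 hC.le) _ _
    · change |C⁻¹ * y a| ≤ 1
      rw [abs_mul, abs_of_pos (inv_pos.2 hC), inv_mul_le_iff₀ hC, mul_one]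
      exact hyC a
  have h₁ : |C⁻¹ * toFun A f y| ≤ 0 := hf ▸ le_freeNorm hp f
  have h₂ : toFun A f y = 0 := by
    simpa [hC.ne'] using abs_nonpos_iff.1 h₁
  rw [← h₂]
  exact hF x y fun a ha => by simp [y, ha]

end FVL

/-! ### Banach lattices -/

section BanachLattice

/-- A lattice homomorphism from a Banach lattice to a normed lattice is bounded. -/
theorem IsLatticeHom.exists_norm_le {X : Type u} {Y : Type v} [NormedAddCommGroup X]
    [NormedSpace ℝ X] [Lattice X] [IsOrderedAddMonoid X] [IsOrderedModule ℝ X] [HasSolidNorm X]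
    [CompleteSpace X] [NormedAddCommGroup Y] [NormedSpace ℝ Y] [Lattice Y] [IsOrderedAddMonoid Y]
    [HasSolidNorm Y] {T : X →ₗ[ℝ] Y} (hT : IsLatticeHom T) : ∃ C, ∀ x, ‖T x‖ ≤ C * ‖x‖ := by
  by_contra! h
  -- With growth `4 ^ n`, the positive vectors `y n` can have norm `2⁻ⁿ` while their images have
  -- norm at least `2 ^ n`. Their sum dominates each `y n`, so the image of the sum would have
  -- infinite norm.
  choose x hx using fun n : ℕ => h (4 ^ n)
  have hpos : ∀ n, 0 < ‖x n‖ := by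
    intro n
    rw [norm_pos_iff]
    intro h0
    simpa [h0] using hx n
  let y : ℕ → X := fun n => (2 ^ n * ‖x n‖)⁻¹ • |x n|
  have hc : ∀ n, 0 < (2 ^ n * ‖x n‖)⁻¹ := fun n => by have := hpos n; positivity
  have hy0 : ∀ n, 0 ≤ y n := fun n => smul_nonneg (hc n).le (abs_nonneg _)
  have hy : ∀ n, ‖y n‖ = (1 / 2) ^ n := by
    intro n
    rw [norm_smul, norm_abs_eq_norm, Real.norm_of_nonneg (hc n).le, mul_inv, mul_assoc,
      inv_mul_cancel₀ (hpos n).ne', mul_one, one_div, inv_pow]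
  have hsum : Summable y :=
    .of_norm_bounded summable_geometric_two fun n => (hy n).le
  have hle : ∀ n : ℕ, (2 : ℝ) ^ n ≤ ‖T (∑' n, y n)‖ := by
    intro n
    have h₁ : T (y n) ≤ T (∑' n, y n) :=
      hT.monotone (hsum.le_tsum n fun k _ => hy0 k)
    have h₂ : 0 ≤ T (y n) := by simpa using hT.monotone (hy0 n)
    have h₃ : ‖T (y n)‖ ≤ ‖T (∑' n, y n)‖ := norm_le_norm_of_abs_le_abs (by
      rwa [abs_of_nonneg h₂, abs_of_nonneg (h₂.trans h₁)])
    refine le_trans ?_ h₃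
    rw [map_smul, hT.map_abs, norm_smul, norm_abs_eq_norm, Real.norm_of_nonneg (hc n).le,
      inv_mul_eq_div, le_div_iff₀ (by have := hpos n; positivity), ← mul_assoc, ← mul_pow]
    norm_num
    exact (hx n).le
  obtain ⟨n, hn⟩ := pow_unbounded_of_one_lt ‖T (∑' n, y n)‖ (one_lt_two (α := ℝ))
  exact absurd (hle n) hn.not_ge

theorem IsLatticeHom.continuous {X : Type u} {Y : Type v} [NormedAddCommGroup X]
    [NormedSpace ℝ X] [Lattice X] [IsOrderedAddMonoid X] [IsOrderedModule ℝ X] [HasSolidNorm X]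
    [CompleteSpace X] [NormedAddCommGroup Y] [NormedSpace ℝ Y] [Lattice Y] [IsOrderedAddMonoid Y]
    [HasSolidNorm Y] {T : X →ₗ[ℝ] Y} (hT : IsLatticeHom T) : Continuous T := by
  obtain ⟨C, hC⟩ := hT.exists_norm_le
  exact AddMonoidHomClass.continuous_of_bound T C hC

/-- A lattice homomorphism that is dominated by the norm extends to the completion. -/
theorem IsLatticeCompletion.exists_extension {L : Type u} [AddCommGroup L] [Module ℝ L]
    [Lattice L] {p : Seminorm ℝ L} {X : Type w} [NormedAddCommGroup X] [NormedSpace ℝ X]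
    [Lattice X] [IsOrderedAddMonoid X] [IsOrderedModule ℝ X] [HasSolidNorm X] [CompleteSpace X]
    {j : L →ₗ[ℝ] X} (hj : IsLatticeCompletion p j) {Y : Type v} [NormedAddCommGroup Y]
    [NormedSpace ℝ Y] [Lattice Y] [IsOrderedAddMonoid Y] [HasSolidNorm Y] [CompleteSpace Y]
    {T : L →ₗ[ℝ] Y} (hT : IsLatticeHom T) (hTp : ∀ f, ‖T f‖ ≤ p f) :
    ∃ S : X →ₗ[ℝ] Y, IsLatticeHom S ∧ (∀ f, S (j f) = T f) ∧ ∀ x, ‖S x‖ ≤ ‖x‖ := by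
  have hbound : ∀ f, ‖T f‖ ≤ 1 * ‖j f‖ := fun f => by rw [one_mul, hj.norm_eq]; exact hTp f
  have heq : ∀ f, T.extendOfNorm j (j f) = T f :=
    LinearMap.extendOfNorm_eq hj.denseRange ⟨1, hbound⟩
  have hc : Continuous (T.extendOfNorm j) := (T.extendOfNorm j).continuous
  refine ⟨(T.extendOfNorm j).toLinearMap, ⟨?_, ?_⟩, heq, fun x => ?_⟩
  · refine hj.denseRange.induction_on₂ (isClosed_eq (by fun_prop) (by fun_prop)) fun f g => ?_
    simp only [ContinuousLinearMap.coe_coe]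
    rw [← hj.isLatticeHom.map_sup, heq, heq, heq, hT.map_sup]
  · refine hj.denseRange.induction_on₂ (isClosed_eq (by fun_prop) (by fun_prop)) fun f g => ?_
    simp only [ContinuousLinearMap.coe_coe]
    rw [← hj.isLatticeHom.map_inf, heq, heq, heq, hT.map_inf]
  · simpa using LinearMap.norm_extendOfNorm_apply_le hj.denseRange 1 hbound x

end BanachLattice

/-! ### The completion of a normed vector lattice -/

namespace UniformSpace.Completion

variable {L : Type u} [NormedAddCommGroup L] [Lattice L] [IsOrderedAddMonoid L] [HasSolidNorm L]

/-- Uniform continuity is what makes the extension of `⊔` to the completion by `Completion.map₂`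
agree with `⊔` on `L`. -/
theorem uniformContinuous_sup : UniformContinuous fun p : L × L => p.1 ⊔ p.2 := by
  refine (LipschitzWith.of_dist_le_mul (K := 2) fun p q => ?_).uniformContinuous
  rw [dist_eq_norm, NNReal.coe_ofNat, two_mul]
  refine (norm_sup_sub_sup_le_add_norm _ _ _ _).trans (add_le_add ?_ ?_)
  · rw [← dist_eq_norm]; exact le_max_left _ _
  · rw [← dist_eq_norm]; exact le_max_right _ _

theorem uniformContinuous_inf : UniformContinuous fun p : L × L => p.1 ⊓ p.2 := by
  have h : (fun p : L × L => p.1 ⊓ p.2) = fun p => -((-p.1) ⊔ (-p.2)) := by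
    ext p
    rw [neg_sup, neg_neg, neg_neg]
  rw [h]
  exact (uniformContinuous_sup.comp
    ((uniformContinuous_fst.neg).prodMk uniformContinuous_snd.neg)).neg

noncomputable instance instMax : Max (Completion L) := ⟨Completion.map₂ (· ⊔ ·)⟩

noncomputable instance instMin : Min (Completion L) := ⟨Completion.map₂ (· ⊓ ·)⟩

theorem coe_sup (a b : L) : ((a ⊔ b : L) : Completion L) = ↑a ⊔ ↑b :=
  (Completion.map₂_coe_coe a b (· ⊔ ·) uniformContinuous_sup).symm

theorem coe_inf (a b : L) : ((a ⊓ b : L) : Completion L) = ↑a ⊓ ↑b :=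
  (Completion.map₂_coe_coe a b (· ⊓ ·) uniformContinuous_inf).symm

instance instContinuousSup : ContinuousSup (Completion L) :=
  ⟨Completion.continuous_map₂ continuous_fst continuous_snd⟩

instance instContinuousInf : ContinuousInf (Completion L) :=
  ⟨Completion.continuous_map₂ continuous_fst continuous_snd⟩

/-- The lattice structure on the completion of a normed lattice. -/
noncomputable instance instLattice : Lattice (Completion L) :=
  Lattice.mk'
    (fun a b => Completion.induction_on₂ a b (isClosed_eq (by fun_prop) (by fun_prop))
      fun a b => by rw [← coe_sup, ← coe_sup, sup_comm])
    (fun a b c => Completion.induction_on₃ a b c (isClosed_eq (by fun_prop) (by fun_prop))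
      fun a b c => by simp only [← coe_sup, sup_assoc])
    (fun a b => Completion.induction_on₂ a b (isClosed_eq (by fun_prop) (by fun_prop))
      fun a b => by rw [← coe_inf, ← coe_inf, inf_comm])
    (fun a b c => Completion.induction_on₃ a b c (isClosed_eq (by fun_prop) (by fun_prop))
      fun a b c => by simp only [← coe_inf, inf_assoc])
    (fun a b => Completion.induction_on₂ a b (isClosed_eq (by fun_prop) (by fun_prop))
      fun a b => by rw [← coe_inf, ← coe_sup, sup_inf_self])
    (fun a b => Completion.induction_on₂ a b (isClosed_eq (by fun_prop) (by fun_prop))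
      fun a b => by rw [← coe_sup, ← coe_inf, inf_sup_self])

theorem sup_add_completion (a b c : Completion L) : (a ⊔ b) + c = (a + c) ⊔ (b + c) :=
  Completion.induction_on₃ a b c (isClosed_eq (by fun_prop) (by fun_prop)) fun a b c => by
    simp only [← coe_sup, ← coe_add, sup_add]

instance instIsOrderedAddMonoid : IsOrderedAddMonoid (Completion L) where
  add_le_add_left a b h c := by
    rw [← sup_eq_right, ← sup_add_completion, sup_eq_right.2 h]

theorem coe_abs (a : L) : ((|a| : L) : Completion L) = |(a : Completion L)| := by
  rw [abs, abs, coe_sup, coe_neg]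

/-- The hypothesis `|a| ≤ |b|` cannot be approximated directly by elements of `L`. Writing `|a|` as
`|a| ⊓ |b|` turns the claim into an inequality for all pairs, which is a closed condition and so
passes from `L`. -/
instance instHasSolidNorm : HasSolidNorm (Completion L) where
  solid := by
    have hcont : Continuous fun a : Completion L => |a| := by
      simp only [abs]
      fun_prop
    have h₁ : ∀ a : Completion L, ‖|a|‖ = ‖a‖ := fun a =>
      Completion.induction_on a (isClosed_eq hcont.norm continuous_norm) fun a => by
        rw [← coe_abs, norm_coe, norm_coe, norm_abs_eq_norm]
    have h₂ : ∀ a b : Completion L, ‖|a| ⊓ |b|‖ ≤ ‖b‖ := fun a b =>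
      Completion.induction_on₂ a b (isClosed_le (((hcont.comp continuous_fst).inf
        (hcont.comp continuous_snd)).norm) continuous_snd.norm) fun a b => by
        rw [← coe_abs, ← coe_abs, ← coe_inf, norm_coe, norm_coe]
        refine norm_le_norm_of_abs_le_abs ?_
        rw [abs_of_nonneg (le_inf (abs_nonneg a) (abs_nonneg b))]
        exact inf_le_right
    intro a b h
    rw [← h₁ a, ← inf_eq_left.2 h]
    exact h₂ a b

instance instIsOrderedModule [NormedSpace ℝ L] [IsOrderedModule ℝ L] :
    IsOrderedModule ℝ (Completion L) :=
  .of_smul_nonneg fun c hc b hb => by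
    have hsmul : Continuous fun a : Completion L => c • a := continuous_const_smul c
    have h₁ : Continuous fun a : Completion L => 0 ⊔ c • a := continuous_const.sup hsmul
    have h₂ : Continuous fun a : Completion L => c • (0 ⊔ a) :=
      hsmul.comp (continuous_const.sup continuous_id)
    -- Positivity of `b` is encoded as `0 ⊔ b = b`, so an identity valid on a dense set suffices.
    have h : ∀ a : Completion L, 0 ⊔ c • a = c • (0 ⊔ a) := fun a =>
      Completion.induction_on a (isClosed_eq h₁ h₂) fun a => by
        rw [← coe_zero, ← coe_sup, ← coe_smul, ← coe_smul, ← coe_sup, smul_sup_of_nonneg hc,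
          smul_zero]
    rw [← sup_eq_right, h, sup_eq_right.2 hb]

end UniformSpace.Completion

/-- Every vector lattice has a completion with respect to a lattice norm. -/
theorem exists_isLatticeCompletion {L : Type u} [AddCommGroup L] [Module ℝ L] [Lattice L]
    [IsOrderedAddMonoid L] [IsOrderedModule ℝ L] {p : Seminorm ℝ L} (hp : IsLatticeNorm p) :
    ∃ (X : Type u) (_ : NormedAddCommGroup X) (_ : NormedSpace ℝ X) (_ : Lattice X)
      (_ : IsOrderedAddMonoid X) (_ : IsOrderedModule ℝ X) (_ : HasSolidNorm X)
      (_ : CompleteSpace X) (j : L →ₗ[ℝ] X), IsLatticeCompletion p j := by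
  let q : AddGroupNorm L :=
    { p.toAddGroupSeminorm with eq_zero_of_map_eq_zero' := fun f hf => hp.2 f hf }
  let _ : NormedAddCommGroup L := q.toNormedAddCommGroup
  let _ : NormedSpace ℝ L := ⟨fun c f => (map_smul_eq_mul p c f).le⟩
  have : HasSolidNorm L := ⟨hp.1⟩
  exact ⟨UniformSpace.Completion L, inferInstance, inferInstance, inferInstance, inferInstance,
    inferInstance, inferInstance, inferInstance,
    (UniformSpace.Completion.toComplL : L →L[ℝ] UniformSpace.Completion L).toLinearMap,
    ⟨UniformSpace.Completion.coe_sup, UniformSpace.Completion.coe_inf⟩,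
    fun f => UniformSpace.Completion.norm_coe f, UniformSpace.Completion.denseRange_coe⟩

/-! ### The free Banach lattice -/

namespace FVL

/-- The completion of `FVL A` with respect to the free norm is a free Banach lattice. -/
theorem isFreeBanachLattice_of_isLatticeCompletion {A : Type u} {X : Type w}
    [NormedAddCommGroup X] [NormedSpace ℝ X] [Lattice X] [IsOrderedAddMonoid X]
    [IsOrderedModule ℝ X] [HasSolidNorm X] [CompleteSpace X] {j : FVL A →ₗ[ℝ] X}
    (hj : IsLatticeCompletion (freeNorm A) j) :
    IsFreeBanachLattice.{u, v, w} fun a : A => j (of a) where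
  injective a b hab := by
    refine of_injective (sub_eq_zero.1 ((isLatticeNorm_freeNorm A).2 _ ?_))
    rw [← hj.norm_eq, map_sub, norm_eq_zero]
    exact sub_eq_zero.2 hab
  norm_le_one a := by
    rw [hj.norm_eq]
    exact (isGreatest_freeNorm A).1.2 a
  exists_extension Y _ _ _ _ _ _ _ φ hφ := by
    obtain ⟨T, hT, hTφ⟩ := exists_lift φ
    -- Maximality of the free norm enters here: it makes the lift contractive.
    have hp : (normSeminorm ℝ Y).comp T ∈ contractiveSeminorms A :=
      ⟨isLatticeSeminorm_comp hT, fun a => by simpa [hTφ] using hφ a⟩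
    obtain ⟨S, hS, hSj, hSn⟩ := hj.exists_extension hT fun f => le_freeNorm hp f
    refine ⟨S, ⟨hS, fun a => (hSj _).trans (hTφ a)⟩, hSn, fun R hR => ?_⟩
    have hRj : R ∘ₗ j = S ∘ₗ j := hom_ext (hR.1.comp hj.isLatticeHom) (hS.comp hj.isLatticeHom)
      fun a => (hR.2 a).trans ((hSj _).trans (hTφ a)).symm
    -- The competitor `R` is not assumed bounded; automatic continuity lets agreement on the dense
    -- range decide.
    refine DFunLike.coe_injective (hj.denseRange.equalizer hR.1.continuous hS.continuous ?_)
    ext f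
    exact LinearMap.congr_fun hRj f

/-- Every free Banach lattice is the completion of `FVL A` with respect to the free norm. -/
theorem exists_isLatticeCompletion_of_isFreeBanachLattice {A : Type u} {X : Type u}
    [NormedAddCommGroup X] [NormedSpace ℝ X] [Lattice X] [IsOrderedAddMonoid X]
    [IsOrderedModule ℝ X] [HasSolidNorm X] [CompleteSpace X] {ι : A → X}
    (hι : IsFreeBanachLattice.{u, u, u} ι) :
    ∃ j : FVL A →ₗ[ℝ] X, (∀ a, j (of a) = ι a) ∧ IsLatticeCompletion (freeNorm A) j := by
  obtain ⟨X', _, _, _, _, _, _, _, j', hj'⟩ :=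
    exists_isLatticeCompletion (isLatticeNorm_freeNorm A)
  have hX' : IsFreeBanachLattice.{u, u, u} fun a : A => j' (of a) :=
    isFreeBanachLattice_of_isLatticeCompletion hj'
  obtain ⟨T, ⟨hT, hTι⟩, hTn, -⟩ := hι.exists_extension X' _ hX'.norm_le_one
  obtain ⟨S, ⟨hS, hSι⟩, hSn, -⟩ := hX'.exists_extension X ι hι.norm_le_one
  -- Applied to the inclusion of the generators itself, uniqueness forces any lattice endomorphism
  -- fixing the generators to be the identity; so `S` and `T` are mutually inverse contractions,
  -- hence isometries.
  obtain ⟨R, -, -, hR⟩ := hι.exists_extension X ι hι.norm_le_one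
  obtain ⟨R', -, -, hR'⟩ := hX'.exists_extension X' _ hX'.norm_le_one
  have hST : S ∘ₗ T = LinearMap.id :=
    (hR _ ⟨hS.comp hT, fun a => by simp [hTι, hSι]⟩).trans
      (hR _ ⟨IsLatticeHom.id, fun _ => rfl⟩).symm
  have hTS : T ∘ₗ S = LinearMap.id :=
    (hR' _ ⟨hT.comp hS, fun a => by simp [hTι, hSι]⟩).trans
      (hR' _ ⟨IsLatticeHom.id, fun _ => rfl⟩).symm
  have hSnorm : ∀ x, ‖S x‖ = ‖x‖ := fun x =>
    (hSn x).antisymm (by simpa [← LinearMap.comp_apply, hTS] using hTn (S x))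
  have hSsurj : Function.Surjective S := fun x => ⟨T x, LinearMap.congr_fun hST x⟩
  exact ⟨S ∘ₗ j', hSι, hS.comp hj'.isLatticeHom, fun f => (hSnorm _).trans (hj'.norm_eq f),
    hSsurj.denseRange.comp hj'.denseRange hS.continuous⟩

end FVL

theorem mainTheorem1 (A : Type u) :
    IsFreeVectorLattice.{u, v, u} (FVL.of : A → FVL A) ∧
    ∃ ν : Seminorm ℝ (FVL A),
      IsGreatest {p : Seminorm ℝ (FVL A) | IsLatticeSeminorm p ∧ ∀ a : A, p (FVL.of a) ≤ 1} ν ∧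
      IsLatticeNorm ν ∧
      -- the completion of `FVL A` with respect to `ν` exists,
      (∃ (X : Type u) (_ : NormedAddCommGroup X) (_ : NormedSpace ℝ X) (_ : Lattice X)
        (_ : IsOrderedAddMonoid X) (_ : IsOrderedModule ℝ X) (_ : HasSolidNorm X)
        (_ : CompleteSpace X) (j : FVL A →ₗ[ℝ] X), IsLatticeCompletion ν j) ∧
      -- it is a free Banach lattice over `A`,
      (∀ (X : Type w) [NormedAddCommGroup X] [NormedSpace ℝ X] [Lattice X]
        [IsOrderedAddMonoid X] [IsOrderedModule ℝ X] [HasSolidNorm X] [CompleteSpace X]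
        (j : FVL A →ₗ[ℝ] X), IsLatticeCompletion ν j →
        IsFreeBanachLattice.{u, v, w} (fun a : A => j (FVL.of a))) ∧
      -- and every free Banach lattice over `A` arises so, its norm being the greatest lattice norm.
      (∀ (X : Type u) [NormedAddCommGroup X] [NormedSpace ℝ X] [Lattice X]
        [IsOrderedAddMonoid X] [IsOrderedModule ℝ X] [HasSolidNorm X] [CompleteSpace X]
        (ι : A → X), IsFreeBanachLattice.{u, u, u} ι →
        ∃ j : FVL A →ₗ[ℝ] X, (∀ a : A, j (FVL.of a) = ι a) ∧ IsLatticeCompletion ν j ∧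
          IsGreatest {p : Seminorm ℝ (FVL A) | IsLatticeNorm p ∧ ∀ a : A, p (FVL.of a) ≤ 1}
            ((normSeminorm ℝ X).comp j)) := by

  refine ⟨FVL.isFreeVectorLattice A, FVL.freeNorm A, FVL.isGreatest_freeNorm A,
    FVL.isLatticeNorm_freeNorm A, exists_isLatticeCompletion (FVL.isLatticeNorm_freeNorm A), ?_, ?_⟩
  · intro X _ _ _ _ _ _ _ j hj
    exact FVL.isFreeBanachLattice_of_isLatticeCompletion hj
  · intro X _ _ _ _ _ _ _ ι hι
    obtain ⟨j, hjι, hj⟩ := FVL.exists_isLatticeCompletion_of_isFreeBanachLattice hι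
    have hν : (normSeminorm ℝ X).comp j = FVL.freeNorm A := Seminorm.ext hj.norm_eq
    refine ⟨j, hjι, hj, ?_⟩
    rw [hν]
    exact ⟨⟨FVL.isLatticeNorm_freeNorm A, (FVL.isGreatest_freeNorm A).1.2⟩,
      fun p hp => FVL.le_freeNorm ⟨hp.1.1, hp.2⟩⟩
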